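/- For a prime $p$, let $M(\mathbb{F}_p)$ be the set of solutions $(x,y,z)\in\mathbb{F}_p^3\setminus\{(0,0,0)\}$ of $x^2+y^2+z^2=xyz$. The Markoff graph mod $p$ has vertex set $M(\mathbb{F}_p)$, and each vertex $(x,y,z)$ is joined by an edge to $(x,y,xy-z)$, $(x,xz-y,z)$ and $(yz-x,y,z)$. Let $A$ be its adjacency matrix: $A_{ij}=1$ if there is an edge between $i$ and $j$ (with $A_{jj}=1$ if there is a loop at $j$), and $A_{ij}=0$ otherwise. Let $\{\lambda_j\}$ be the eigenvalues of $A$, counted with multiplicity. Let $$\rho_3(\lambda)=\frac{3}{2\pi}\,\frac{\sqrt{8-\lambda^2}}{9-\lambda^2}\,\mathbf{1}_{[-2\sqrt2,\,2\sqrt2]}(\lambda)$$ be the Kesten-McKay density for degree $3$. Then for every fixed polynomial $f$ (with real or complex coefficients), $$\frac{1}{p^2\pm 3p}\sum_j f(\lambda_j)=\int_{-2\sqrt2}^{2\sqrt2} f(\lambda)\,\rho_3(\lambda)\,d\lambda+O\!\left(\frac1p\right)$$ as $p\to\infty$ through the primes, where the sign is $+$ if $p\equiv 1 \pmod 4$ and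 $-$ if $p\equiv 3\pmod 4$, and the implied constant depends only on $f$. -/

import Mathlib

open scoped Polynomial

namespace Markoff

/-- A triple is a point of `M(R)`: a solution of `x² + y² + z² = xyz` other than `(0,0,0)`. -/
def IsVertex {R : Type*} [CommRing R] (v : R × R × R) : Prop :=
  v.1 ^ 2 + v.2.1 ^ 2 + v.2.2 ^ 2 = v.1 * v.2.1 * v.2.2 ∧ v ≠ (0, 0, 0)

/-- The Markoff move `(x, y, z) ↦ (yz - x, y, z)`. -/
def move₁ {R : Type*} [CommRing R] (v : R × R × R) : R × R × R :=
  (v.2.1 * v.2.2 - v.1, v.2.1, v.2.2)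

/-- The Markoff move `(x, y, z) ↦ (x, xz - y, z)`. -/
def move₂ {R : Type*} [CommRing R] (v : R × R × R) : R × R × R :=
  (v.1, v.1 * v.2.2 - v.2.1, v.2.2)

/-- The Markoff move `(x, y, z) ↦ (x, y, xy - z)`. -/
def move₃ {R : Type*} [CommRing R] (v : R × R × R) : R × R × R :=
  (v.1, v.2.1, v.1 * v.2.1 - v.2.2)

/-- The vertex set `M(𝔽_p)` of the Markoff graph mod `p`. -/
abbrev Vertex (p : ℕ) : Type :=
  {v : ZMod p × ZMod p × ZMod p // IsVertex v}

/-- The edge relation of the Markoff graph. Loops are allowed: `Adj v v` holds exactly when `v` is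
fixed by one of the three moves. -/
def Adj {p : ℕ} (v w : Vertex p) : Prop :=
  w.1 = move₁ v.1 ∨ w.1 = move₂ v.1 ∨ w.1 = move₃ v.1

theorem Adj.symm {p : ℕ} {v w : Vertex p} (h : Adj v w) : Adj w v := by
  rcases h with h | h | h
  · exact Or.inl (by rw [h]; simp [move₁])
  · exact Or.inr (Or.inl (by rw [h]; simp [move₂]))
  · exact Or.inr (Or.inr (by rw [h]; simp [move₃]))

noncomputable section

open scoped Classical in
/-- The adjacency matrix of the Markoff graph mod `p`: the `(v, w)` entry is `1` if there is an edge
between `v` and `w` and `0` otherwise; in particular a loop contributes `1` on the diagonal. -/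
def adjMatrix (p : ℕ) : Matrix (Vertex p) (Vertex p) ℝ :=
  Matrix.of fun v w => if Adj v w then 1 else 0

theorem isHermitian_adjMatrix (p : ℕ) : (adjMatrix p).IsHermitian := by
  ext v w
  have h : Adj w v ↔ Adj v w := ⟨Adj.symm, Adj.symm⟩
  by_cases hv : Adj v w <;> simp [adjMatrix, h, hv]

instance (p : ℕ) [NeZero p] : Fintype (Vertex p) := Fintype.ofFinite _

/-- The eigenvalues `λ_j` of the Markoff graph mod `p`, listed with multiplicity
(as many as there are vertices). -/
def eigenvalue (p : ℕ) [NeZero p] : Vertex p → ℝ :=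
  (isHermitian_adjMatrix p).eigenvalues

/-- The number `p² ± 3p`: the sign is `+` if `p ≡ 1 (mod 4)` and `-` if `p ≡ 3 (mod 4)`. -/
def normalization (p : ℕ) : ℝ :=
  if p % 4 = 1 then (p : ℝ) ^ 2 + 3 * p else (p : ℝ) ^ 2 - 3 * p

/-- The Kesten-McKay density `ρ_d`. -/
def kestenMcKay (d : ℕ) : ℝ → ℝ :=
  Set.indicator (Set.Icc (-(2 * √((d : ℝ) - 1))) (2 * √((d : ℝ) - 1))) fun x =>
    d / (2 * Real.pi) * (√(4 * ((d : ℝ) - 1) - x ^ 2) / ((d : ℝ) ^ 2 - x ^ 2))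

end

end Markoff

/-!
The trace of a polynomial in the adjacency matrix `A` is the sum of its values at the eigenvalues, so
the theorem is a statement about closed walks. Up to `O(p)` entries, `A` is the sum of the three
permutation matrices of the Markoff moves, and the moves are involutions. Hence the nonbacktracking
polynomials `q_n` of the 3-regular tree, evaluated at `A`, are close in the entrywise `ℓ¹` norm to
the sums of the permutation matrices of the reduced words in the moves
(`isBigO_entrySum_aeval_sub`), and the trace of such a permutation matrix is the number of fixed
points of the word.

The key point is that a nonempty reduced word has only `O(p)` fixed points
(`isBigO_ncard_fixedPoints`). The fixed points are cut out on the surface by integer polynomials.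
These do not all vanish identically, because the word moves the integer point `(3, 3, 3)`: along a
reduced word the largest coordinate strictly grows (`coords_moveWord_lt`). A polynomial `g` that is
nonzero at some integer point of the surface has `O(p)` zeros there (`isBigO_card_surfaceZeros`):
its norm from the surface, a double cover, down to the `(x, y)`-plane is a nonzero polynomial, whose
zeros mod `p` are bounded by the Schwartz–Zippel lemma. The norm is nonzero since over the real
square `0 < x, y < 1` the two values of `z` are complex conjugate, so that the norm form is positive
definite.

The number of vertices is `p² + O(p)` (`isBigO_card_vertex_sub_sq`) because each line through the
origin, off a curve of exceptions, contains exactly one nonzero solution.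

On the analytic side, the substitution `x = 2√2 cos θ` turns the Kesten–McKay density into
`(12/π) sin² θ / (5 - 4 cos 2θ)`. The Fourier coefficients of the Poisson kernel
`1 / (5 - 4 cos 2θ)` satisfy a linear recurrence whose bounded solutions are halved by a shift by
two, and this gives `∫ ρ₃ = 1` and `∫ q_n ρ₃ = 0` (`integral_kestenMcKay`,
`integral_nonbacktracking_mul_kestenMcKay`). As `1` and the `q_n` span all polynomials
(`span_nonbacktracking_eq_top`), linearity finishes the proof.
-/

namespace Markoff

open Filter Asymptotics MvPolynomial

/-! ### Asymptotics along the primes -/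

/-- The primes, as a type, tending to infinity. -/
def primesAtTop : Filter Nat.Primes :=
  comap (fun p : Nat.Primes => (p : ℕ)) atTop

instance factPrime (p : Nat.Primes) : Fact (p : ℕ).Prime := ⟨p.2⟩

theorem eventually_lt_prime (N : ℕ) : ∀ᶠ p : Nat.Primes in primesAtTop, N < (p : ℕ) :=
  tendsto_comap.eventually (eventually_gt_atTop N)

theorem isBigO_prime_of_le {F : Nat.Primes → ℕ} {N C : ℕ}
    (h : ∀ p : Nat.Primes, N < (p : ℕ) → F p ≤ C * (p : ℕ)) :
    (fun p => (F p : ℝ)) =O[primesAtTop] fun p => ((p : ℕ) : ℝ) := by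
  refine IsBigO.of_bound C ?_
  filter_upwards [eventually_lt_prime N] with p hp
  rw [Real.norm_natCast, Real.norm_natCast]
  exact_mod_cast h p hp

/-! ### Zeros of integer polynomials on the plane and on the Markoff surface -/

/-- A nonzero integer polynomial stays nonzero modulo every `p` exceeding one of its nonzero
coefficients. -/
theorem exists_map_intCast_ne_zero {σ : Type*} {n : MvPolynomial σ ℤ} (hn : n ≠ 0) :
    ∃ N : ℕ, ∀ p : ℕ, N < p → map (Int.castRingHom (ZMod p)) n ≠ 0 := by
  obtain ⟨d, hd⟩ := MvPolynomial.ne_zero_iff.1 hn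
  refine ⟨(coeff d n).natAbs, fun p hp h => hd ?_⟩
  have h1 := congrArg (coeff d) h
  rw [coeff_map, coeff_zero, eq_intCast, ZMod.intCast_zmod_eq_zero_iff_dvd] at h1
  exact Int.eq_zero_of_dvd_of_natAbs_lt_natAbs h1 (by simpa using hp)

theorem exists_card_planeZeros_le {n : MvPolynomial (Fin 2) ℤ} (hn : n ≠ 0) :
    ∃ N C : ℕ, ∀ p : Nat.Primes, N < (p : ℕ) →
      Nat.card {v : Fin 2 → ZMod p // aeval v n = 0} ≤ C * (p : ℕ) := by
  classical
  obtain ⟨N, hN⟩ := exists_map_intCast_ne_zero hn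
  refine ⟨N, n.totalDegree, fun p hp => ?_⟩
  have h := schwartz_zippel_totalDegree (hN p hp) Finset.univ
  have hcard : Nat.card {v : Fin 2 → ZMod p // aeval v n = 0} =
      (Finset.filter (fun v : Fin 2 → ZMod p => eval v (map (Int.castRingHom (ZMod p)) n) = 0)
        (Fintype.piFinset fun _ => Finset.univ)).card := by
    rw [Nat.card_eq_fintype_card, Fintype.card_subtype]
    congr 1
    ext v
    rw [Finset.mem_filter, Finset.mem_filter]
    simp [eval_map, aeval_def, algebraMap_int_eq]
  rw [← hcard, Finset.card_univ, ZMod.card] at h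
  have hp0 : (0 : ℚ≥0) < (p : ℕ) := by exact_mod_cast p.2.pos
  rw [div_le_div_iff₀ (by positivity) hp0] at h
  have hdeg : (map (Int.castRingHom (ZMod p)) n).totalDegree ≤ n.totalDegree :=
    Finset.sup_mono (support_map_subset _ _)
  have h2 : Nat.card {v : Fin 2 → ZMod p // aeval v n = 0} * (p : ℕ) ≤
      (map (Int.castRingHom (ZMod p)) n).totalDegree * (p : ℕ) ^ 2 := by exact_mod_cast h
  refine Nat.le_of_mul_le_mul_right (h2.trans ?_) p.2.pos
  calc _ ≤ n.totalDegree * (p : ℕ) ^ 2 := Nat.mul_le_mul_right _ hdeg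
    _ = _ := by ring

/-- A nonzero integer polynomial in two variables has `O(p)` zeros in `𝔽_p²`. -/
theorem isBigO_card_planeZeros {n : MvPolynomial (Fin 2) ℤ} (hn : n ≠ 0) :
    (fun p : Nat.Primes => (Nat.card {v : Fin 2 → ZMod p // aeval v n = 0} : ℝ))
      =O[primesAtTop] fun p => ((p : ℕ) : ℝ) := by
  obtain ⟨N, C, h⟩ := exists_card_planeZeros_le hn
  exact isBigO_prime_of_le h

/-- On the Markoff surface, `z² = xyz - x² - y²`, so every polynomial function is linear in `z`. -/
theorem exists_aeval_eq_add_mul (g : MvPolynomial (Fin 3) ℤ) :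
    ∃ a b : MvPolynomial (Fin 2) ℤ, ∀ {S : Type} [CommRing S] (x y z : S),
      x ^ 2 + y ^ 2 + z ^ 2 = x * y * z →
        aeval ![x, y, z] g = aeval ![x, y] a + aeval ![x, y] b * z := by
  induction g using MvPolynomial.induction_on with
  | C n => exact ⟨C n, 0, fun x y z _ => by simp⟩
  | add g h hg hh =>
    obtain ⟨a, b, hab⟩ := hg
    obtain ⟨c, d, hcd⟩ := hh
    exact ⟨a + c, b + d, fun x y z e => by
      rw [map_add, map_add, map_add, hab x y z e, hcd x y z e]; ring⟩
  | mul_X g i hg =>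
    obtain ⟨a, b, hab⟩ := hg
    fin_cases i
    · exact ⟨a * X 0, b * X 0, fun x y z e => by
        simp only [map_mul, aeval_X, hab x y z e]; simp; ring⟩
    · exact ⟨a * X 1, b * X 1, fun x y z e => by
        simp only [map_mul, aeval_X, hab x y z e]; simp; ring⟩
    · exact ⟨-b * (X 0 ^ 2 + X 1 ^ 2), a + b * X 0 * X 1, fun x y z e => by
        simp only [map_mul, map_add, map_neg, map_pow, aeval_X, hab x y z e]
        simp only [Fin.reduceFinMk, Matrix.cons_val, Matrix.cons_val_zero, Matrix.cons_val_one]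
        linear_combination (aeval ![x, y] b) * e⟩

/-- The norm of the function `a + b z` from the Markoff surface to the `(x, y)`-plane, that is
`(a + b z) (a + b z')` where `z` and `z'` are the two roots of `T² - xyT + x² + y²`. -/
noncomputable def surfaceNorm (a b : MvPolynomial (Fin 2) ℤ) : MvPolynomial (Fin 2) ℤ :=
  a ^ 2 + a * b * (X 0 * X 1) + b ^ 2 * (X 0 ^ 2 + X 1 ^ 2)

theorem aeval_surfaceNorm {S : Type*} [CommRing S] (a b : MvPolynomial (Fin 2) ℤ) (v : Fin 2 → S) :
    aeval v (surfaceNorm a b) = aeval v a ^ 2 + aeval v a * aeval v b * (v 0 * v 1) +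
      aeval v b ^ 2 * (v 0 ^ 2 + v 1 ^ 2) := by
  simp [surfaceNorm]

theorem eq_zero_of_aeval_eq_zero {n : MvPolynomial (Fin 2) ℤ}
    (h : ∀ v : Fin 2 → ℝ, (∀ i, v i ∈ Set.Ioo (0 : ℝ) 1) → aeval v n = 0) : n = 0 := by
  apply map_injective (Int.castRingHom ℝ) Int.cast_injective
  rw [map_zero]
  refine funext_set (fun _ => Set.Ioo (0 : ℝ) 1) (fun _ => Set.Ioo_infinite one_pos) fun v hv => ?_
  rw [map_zero, eval_map, ← algebraMap_int_eq, ← aeval_def]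
  exact h v fun i => hv i (Set.mem_univ i)

/-- Over the real square `0 < x, y < 1` the surface has no real points, so the norm form is positive
definite there: it cannot vanish identically unless `a = b = 0`. -/
theorem eq_zero_of_surfaceNorm_eq_zero {a b : MvPolynomial (Fin 2) ℤ} (h : surfaceNorm a b = 0) :
    a = 0 ∧ b = 0 := by
  have key : ∀ v : Fin 2 → ℝ, (∀ i, v i ∈ Set.Ioo (0 : ℝ) 1) → aeval v a = 0 ∧ aeval v b = 0 := by
    intro v hv
    have h1 := aeval_surfaceNorm a b v
    rw [h, map_zero] at h1
    obtain ⟨hs, hs1⟩ := hv 0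
    obtain ⟨ht, ht1⟩ := hv 1
    set s := v 0
    set t := v 1
    have hst : 0 < 4 * (s ^ 2 + t ^ 2) - (s * t) ^ 2 := by
      have : (s * t) ^ 2 < s ^ 2 := by
        rw [mul_pow]
        exact mul_lt_of_lt_one_right (by positivity) (pow_lt_one₀ ht.le ht1 two_ne_zero)
      nlinarith
    have h2 : (2 * aeval v a + aeval v b * (s * t)) ^ 2 +
        aeval v b ^ 2 * (4 * (s ^ 2 + t ^ 2) - (s * t) ^ 2) = 0 := by linear_combination -4 * h1
    have h3 := (add_eq_zero_iff_of_nonneg (sq_nonneg _)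
      (mul_nonneg (sq_nonneg _) hst.le)).1 h2
    have hb : aeval v b = 0 := by
      simpa [hst.ne'] using h3.2
    have ha := h3.1
    rw [hb] at ha
    exact ⟨by simpa using ha, hb⟩
  exact ⟨eq_zero_of_aeval_eq_zero fun v hv => (key v hv).1,
    eq_zero_of_aeval_eq_zero fun v hv => (key v hv).2⟩

/-- The coordinates of a triple, as a valuation of the variables. -/
def coords {R : Type*} (v : R × R × R) : Fin 3 → R := ![v.1, v.2.1, v.2.2]

/-- A polynomial that does not vanish at every integer point of the Markoff surface has `O(p)` zeros
on the surface mod `p`: its norm to the plane is a nonzero polynomial vanishing below each zero, and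
at most two points of the surface lie above a point of the plane. -/
theorem isBigO_card_surfaceZeros {g : MvPolynomial (Fin 3) ℤ} {w : ℤ × ℤ × ℤ} (hw : IsVertex w)
    (hg : aeval (coords w) g ≠ 0) :
    (fun p : Nat.Primes => (Nat.card {v : Vertex p // aeval (coords v.1) g = 0} : ℝ))
      =O[primesAtTop] fun p => ((p : ℕ) : ℝ) := by
  classical
  obtain ⟨a, b, hab⟩ := exists_aeval_eq_add_mul g
  have hn : surfaceNorm a b ≠ 0 := by
    intro h0
    obtain ⟨rfl, rfl⟩ := eq_zero_of_surfaceNorm_eq_zero h0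
    exact hg ((hab _ _ _ hw.1).trans (by simp))
  obtain ⟨N, C, hC⟩ := exists_card_planeZeros_le hn
  refine isBigO_prime_of_le (N := N) (C := 2 * C) fun p hp => ?_
  refine le_trans ?_ ((Nat.mul_le_mul_left 2 (hC p hp)).trans_eq (mul_assoc _ _ _).symm)
  rw [Nat.card_eq_fintype_card, Fintype.card_subtype, Nat.card_eq_fintype_card,
    Fintype.card_subtype]
  refine Finset.card_le_mul_card_image_of_maps_to (f := fun v : Vertex p => ![v.1.1, v.1.2.1])
    (fun v hv => ?_) 2 fun u _ => ?_
  · simp only [Finset.mem_univ, true_and, Finset.mem_filter] at hv ⊢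
    have h1 := hab _ _ _ v.2.1
    rw [show ![v.1.1, v.1.2.1, v.1.2.2] = coords v.1 from rfl, hv] at h1
    rw [aeval_surfaceNorm]
    simp only [Matrix.cons_val_zero, Matrix.cons_val_one]
    set α := aeval ![v.1.1, v.1.2.1] a
    set β := aeval ![v.1.1, v.1.2.1] b
    linear_combination (-(α + β * (v.1.1 * v.1.2.1 - v.1.2.2))) * h1 + β ^ 2 * v.2.1
  · by_contra! hlt
    obtain ⟨v, hv⟩ := Finset.card_pos.1 (pos_of_gt hlt)
    -- The fibre through `v` consists of `v` and its image under the third move.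
    have hsub : (Finset.filter (fun v : Vertex p => ![v.1.1, v.1.2.1] = u)
        (Finset.filter (fun v : Vertex p => aeval (coords v.1) g = 0) Finset.univ)).image
          Subtype.val ⊆ {v.1, move₃ v.1} := by
      intro q hq
      obtain ⟨q, hq', rfl⟩ := Finset.mem_image.1 hq
      have hqv := (Finset.mem_filter.1 hq').2.trans (Finset.mem_filter.1 hv).2.symm
      have hx : q.1.1 = v.1.1 := by simpa using congrFun hqv 0
      have hy : q.1.2.1 = v.1.2.1 := by simpa using congrFun hqv 1
      have e1 := q.2.1
      have e2 := v.2.1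
      rw [hx, hy] at e1
      have h0 : (q.1.2.2 - v.1.2.2) * (q.1.2.2 - (v.1.1 * v.1.2.1 - v.1.2.2)) = 0 := by
        linear_combination e1 - e2
      rcases mul_eq_zero.1 h0 with h | h
      · simp [Prod.ext_iff, hx, hy, sub_eq_zero.1 h]
      · simp [Prod.ext_iff, move₃, hx, hy, sub_eq_zero.1 h]
    have := Finset.card_le_card hsub
    rw [Finset.card_image_of_injective _ Subtype.val_injective] at this
    exact absurd (this.trans Finset.card_le_two) (not_le.2 hlt)

end Markoff

namespace Markoff
open Filter Asymptotics MvPolynomial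

theorem isVertex_three : IsVertex ((3, 3, 3) : ℤ × ℤ × ℤ) := by
  constructor <;> norm_num

/-! ### The number of vertices -/

/-- The solutions with `xyz ≠ 0` are parametrised by their ratios: on the line through `(u, v, 1)`
the only nonzero solution is `t (u, v, 1)` with `t = (u² + v² + 1) / (uv)`. -/
def vertexEquivPlane (p : ℕ) [Fact p.Prime] :
    {v : Vertex p // aeval (coords v.1) (X 0 * X 1 * X 2 : MvPolynomial (Fin 3) ℤ) ≠ 0} ≃
      {u : Fin 2 → ZMod p //
        aeval u (X 0 * X 1 * (X 0 ^ 2 + X 1 ^ 2 + 1) : MvPolynomial (Fin 2) ℤ) ≠ 0} where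
  toFun v := ⟨![v.1.1.1 / v.1.1.2.2, v.1.1.2.1 / v.1.1.2.2], by
    obtain ⟨⟨⟨x, y, z⟩, e, -⟩, h⟩ := v
    simp only [coords, map_mul, aeval_X, Matrix.cons_val, Matrix.cons_val_zero,
      Matrix.cons_val_one, mul_ne_zero_iff] at h e
    obtain ⟨⟨hx, hy⟩, hz⟩ := h
    have : x / z * (y / z) * ((x / z) ^ 2 + (y / z) ^ 2 + 1) = (x * y) ^ 2 / z ^ 3 := by
      field_simp
      linear_combination e
    simp [this, hx, hy, hz]⟩
  invFun u := ⟨⟨((u.1 0 ^ 2 + u.1 1 ^ 2 + 1) / u.1 1, (u.1 0 ^ 2 + u.1 1 ^ 2 + 1) / u.1 0,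
      (u.1 0 ^ 2 + u.1 1 ^ 2 + 1) / (u.1 0 * u.1 1)), by
    obtain ⟨u, h⟩ := u
    simp only [map_mul, map_add, map_pow, map_one, aeval_X, mul_ne_zero_iff] at h
    obtain ⟨⟨hu, hv⟩, h⟩ := h
    constructor
    · field_simp
    · simp [hu, hv, h]⟩, by
    obtain ⟨u, h⟩ := u
    simp only [map_mul, map_add, map_pow, map_one, aeval_X, mul_ne_zero_iff] at h
    obtain ⟨⟨hu, hv⟩, h⟩ := h
    simp [coords, hu, hv, h]⟩
  left_inv v := by
    obtain ⟨⟨⟨x, y, z⟩, e, -⟩, h⟩ := v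
    simp only [coords, map_mul, aeval_X, Matrix.cons_val, Matrix.cons_val_zero,
      Matrix.cons_val_one, mul_ne_zero_iff] at h e
    obtain ⟨⟨hx, hy⟩, hz⟩ := h
    refine Subtype.ext (Subtype.ext (Prod.ext ?_ (Prod.ext ?_ ?_))) <;>
      simp only [Matrix.cons_val_zero, Matrix.cons_val_one] <;> field_simp <;> linear_combination e
  right_inv u := by
    obtain ⟨u, h⟩ := u
    simp only [map_mul, map_add, map_pow, map_one, aeval_X, mul_ne_zero_iff] at h
    obtain ⟨⟨hu, hv⟩, h⟩ := h
    ext i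
    fin_cases i
    · simp; field_simp
    · simp; field_simp

/-- `|M(𝔽_p)| = p² + O(p)`. -/
theorem isBigO_card_vertex_sub_sq :
    (fun p : Nat.Primes => (Nat.card (Vertex p) : ℝ) - ((p : ℕ) : ℝ) ^ 2)
      =O[primesAtTop] fun p => ((p : ℕ) : ℝ) := by
  classical
  have h1 := isBigO_card_surfaceZeros (g := X 0 * X 1 * X 2) isVertex_three (by simp [coords])
  have h2 := isBigO_card_planeZeros (n := X 0 * X 1 * (X 0 ^ 2 + X 1 ^ 2 + 1)) (by
    intro h
    have := congrArg (aeval (fun _ => (1 : ℤ))) h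
    simp at this)
  refine (h1.sub h2).congr_left fun p => ?_
  have e := Nat.card_congr (vertexEquivPlane p)
  have e1 := Nat.card_congr (Equiv.sumCompl fun v : Vertex p =>
    aeval (coords v.1) (X 0 * X 1 * X 2 : MvPolynomial (Fin 3) ℤ) = 0)
  have e2 := Nat.card_congr (Equiv.sumCompl fun u : Fin 2 → ZMod p =>
    aeval u (X 0 * X 1 * (X 0 ^ 2 + X 1 ^ 2 + 1) : MvPolynomial (Fin 2) ℤ) = 0)
  rw [Nat.card_sum] at e1 e2
  have e3 : Nat.card (Fin 2 → ZMod p) = (p : ℕ) ^ 2 := by simp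
  rw [e3] at e2
  have e1' := congrArg (Nat.cast : ℕ → ℝ) e1
  have e2' := congrArg (Nat.cast : ℕ → ℝ) e2
  have e' := congrArg (Nat.cast : ℕ → ℝ) e
  push_cast at e1' e2' e'
  linarith

/-! ### Words in the three moves -/

section Moves
variable {R S : Type*} [CommRing R] [CommRing S]

/-- The three Markoff moves, indexed by `Fin 3`. -/
def move : Fin 3 → R × R × R → R × R × R := ![move₁, move₂, move₃]

/-- The composition of moves prescribed by a word; the last letter acts first. -/
def moveWord (w : List (Fin 3)) (v : R × R × R) : R × R × R := w.foldr move v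

@[simp] theorem move_move (i : Fin 3) (v : R × R × R) : move i (move i v) = v := by
  fin_cases i <;> simp [move, move₁, move₂, move₃]

@[simp] theorem move_zero (i : Fin 3) : move i ((0, 0, 0) : R × R × R) = (0, 0, 0) := by
  fin_cases i <;> simp [move, move₁, move₂, move₃]

theorem IsVertex.move {v : R × R × R} (hv : IsVertex v) (i : Fin 3) : IsVertex (move i v) := by
  constructor
  · have e := hv.1
    fin_cases i <;> simp [Markoff.move, move₁, move₂, move₃] <;> linear_combination e
  · intro h
    apply hv.2
    rw [← move_move i v, h, move_zero]

theorem map_move (f : R →+* S) (i : Fin 3) (v : R × R × R) :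
    Prod.map f (Prod.map f f) (move i v) = move i (Prod.map f (Prod.map f f) v) := by
  fin_cases i <;> simp [move, move₁, move₂, move₃, Prod.ext_iff]

theorem map_moveWord (f : R →+* S) (w : List (Fin 3)) (v : R × R × R) :
    Prod.map f (Prod.map f f) (moveWord w v) = moveWord w (Prod.map f (Prod.map f f) v) := by
  induction w with
  | nil => rfl
  | cons i w ih => exact (map_move f i _).trans (congrArg (move i) ih)

end Moves

theorem coords_injective {R : Type*} : Function.Injective (coords : R × R × R → Fin 3 → R) :=
  fun _ _ h => Prod.ext (congrFun h 0) (Prod.ext (congrFun h 1) (congrFun h 2))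

/-- A reduced nonempty word applied to `(3, 3, 3)` gives a triple whose strictly largest coordinate
is the one moved last. -/
theorem coords_moveWord_lt {i : Fin 3} {w : List (Fin 3)} (hw : (i :: w).IsChain (· ≠ ·)) :
    (∀ j, 3 ≤ coords (moveWord (i :: w) ((3, 3, 3) : ℤ × ℤ × ℤ)) j) ∧
      ∀ j, j ≠ i → coords (moveWord (i :: w) ((3, 3, 3) : ℤ × ℤ × ℤ)) j <
        coords (moveWord (i :: w) ((3, 3, 3) : ℤ × ℤ × ℤ)) i := by
  induction w generalizing i with
  | nil => revert i; simp only [moveWord, move, coords]; decide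
  | cons k w ih =>
    rw [List.isChain_cons_cons] at hw
    obtain ⟨h3, hlt⟩ := ih hw.2
    have hik := hw.1
    change (∀ j, 3 ≤ coords (move i (moveWord (k :: w) _)) j) ∧
      ∀ j, j ≠ i → coords (move i (moveWord (k :: w) _)) j < coords (move i (moveWord (k :: w) _)) i
    generalize moveWord (k :: w) ((3, 3, 3) : ℤ × ℤ × ℤ) = v at h3 hlt
    obtain ⟨x, y, z⟩ := v
    fin_cases i <;> fin_cases k <;>
      simp [coords, move, move₁, move₂, move₃, Fin.forall_fin_succ] at * <;>
      refine ⟨⟨?_, ?_, ?_⟩, ?_, ?_⟩ <;> nlinarith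

theorem moveWord_three_ne {w : List (Fin 3)} (hw : w.IsChain (· ≠ ·)) (h0 : w ≠ []) :
    moveWord w ((3, 3, 3) : ℤ × ℤ × ℤ) ≠ (3, 3, 3) := by
  obtain ⟨i, w, rfl⟩ := List.exists_cons_of_ne_nil h0
  intro h
  have := (coords_moveWord_lt hw).2 (i + 1) (by fin_cases i <;> decide)
  rw [h] at this
  fin_cases i <;> simp [coords] at this

/-- A Markoff move as a permutation of the vertices. -/
def movePerm (p : ℕ) (i : Fin 3) : Equiv.Perm (Vertex p) :=
  Function.Involutive.toPerm (fun v => ⟨move i v.1, v.2.move i⟩) fun v => by simp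

theorem movePerm_apply_val {p : ℕ} (i : Fin 3) (v : Vertex p) :
    (movePerm p i v).1 = move i v.1 := rfl

theorem movePerm_movePerm {p : ℕ} (i : Fin 3) (v : Vertex p) :
    movePerm p i (movePerm p i v) = v :=
  Subtype.ext (move_move i v.1)

theorem movePerm_mul_self (p : ℕ) (i : Fin 3) : movePerm p i * movePerm p i = 1 :=
  Equiv.ext (movePerm_movePerm i)

/-- The action of a word in the moves on the vertices. -/
def wordPerm (p : ℕ) (w : List (Fin 3)) : Equiv.Perm (Vertex p) := (w.map (movePerm p)).prod

theorem wordPerm_cons (p : ℕ) (i : Fin 3) (w : List (Fin 3)) :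
    wordPerm p (i :: w) = movePerm p i * wordPerm p w := rfl

theorem wordPerm_apply_val {p : ℕ} (w : List (Fin 3)) (v : Vertex p) :
    (wordPerm p w v).1 = moveWord w v.1 := by
  induction w with
  | nil => rfl
  | cons i w ih => exact congrArg (move i) ih

/-- Every nonempty reduced word has `O(p)` fixed points. -/
theorem isBigO_ncard_fixedPoints {w : List (Fin 3)} (hw : w.IsChain (· ≠ ·)) (h0 : w ≠ []) :
    (fun p : Nat.Primes => ((Function.fixedPoints (wordPerm p w)).ncard : ℝ))
      =O[primesAtTop] fun p => ((p : ℕ) : ℝ) := by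
  -- The generic point; the word sends it to a triple of polynomials that specializes to every ring.
  let G : MvPolynomial (Fin 3) ℤ × MvPolynomial (Fin 3) ℤ × MvPolynomial (Fin 3) ℤ :=
    (X 0, X 1, X 2)
  have hG : ∀ {S : Type} [CommRing S] (v : S × S × S) (i : Fin 3),
      aeval (coords v) (coords (moveWord w G) i - X i) = coords (moveWord w v) i - coords v i := by
    intro S _ v i
    have h1 := map_moveWord (aeval (coords v) : MvPolynomial (Fin 3) ℤ →ₐ[ℤ] S).toRingHom w G
    have h2 : Prod.map (aeval (coords v) : MvPolynomial (Fin 3) ℤ →ₐ[ℤ] S).toRingHom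
        (Prod.map (aeval (coords v) : MvPolynomial (Fin 3) ℤ →ₐ[ℤ] S).toRingHom
          (aeval (coords v) : MvPolynomial (Fin 3) ℤ →ₐ[ℤ] S).toRingHom) G = v := by
      simp [G, coords]
    rw [h2] at h1
    rw [map_sub, aeval_X, ← h1]
    congr 1
    fin_cases i <;> rfl
  obtain ⟨i, hi⟩ := Function.ne_iff.1 (coords_injective.ne (moveWord_three_ne hw h0))
  refine (IsBigO.of_norm_le fun p => ?_).trans (isBigO_card_surfaceZeros
    (g := coords (moveWord w G) i - X i) isVertex_three (by rw [hG]; exact sub_ne_zero.2 hi))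
  rw [Real.norm_natCast, ← Nat.card_coe_set_eq]
  refine Nat.cast_le.2 (Nat.card_le_card_of_injective
    (fun v : Function.fixedPoints (wordPerm p w) => ⟨v.1, ?_⟩) fun v v' h => ?_)
  · have hv : wordPerm p w v.1 = v.1 := v.2
    rw [hG, ← wordPerm_apply_val, hv, sub_self]
  · exact Subtype.ext (congrArg (fun u => u.1) h)

end Markoff

namespace Markoff
open Filter Asymptotics

/-! ### Nonbacktracking polynomials -/

/-- The nonbacktracking polynomials of a 3-regular graph: in the adjacency operator, the one of
index `n` counts the nonbacktracking walks of length `n + 1`. -/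
noncomputable def nonbacktracking : ℕ → ℝ[X]
  | 0 => Polynomial.X
  | 1 => Polynomial.X ^ 2 - 3
  | n + 2 => Polynomial.X * nonbacktracking (n + 1) - 2 * nonbacktracking n

/-- The sum of the products `s i * s i₁ * ⋯ * s iₙ` over the reduced words (consecutive letters
distinct) of length `n + 1` with first letter `i`. -/
def reducedSum {A : Type*} [Ring A] (s : Fin 3 → A) : ℕ → Fin 3 → A
  | 0, i => s i
  | n + 1, i => s i * ∑ j ∈ Finset.univ.erase i, reducedSum s n j

/-- The recurrence of the nonbacktracking polynomials: a further letter either extends a reduced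
word, or cancels its first letter; a reduced word arises by cancellation in two ways, one for each
letter that may precede it. -/
theorem sum_mul_reducedSum {A : Type*} [Ring A] {s : Fin 3 → A} (hs : ∀ i, s i * s i = 1) (n : ℕ) :
    (∑ i, s i) * ∑ i, reducedSum s (n + 1) i =
      (∑ i, reducedSum s (n + 2) i) + 2 * ∑ i, reducedSum s n i := by
  have h1 : ∀ i, s i * ∑ j, reducedSum s (n + 1) j =
      reducedSum s (n + 2) i + ((∑ j, reducedSum s n j) - reducedSum s n i) := by
    intro i
    rw [← Finset.sum_erase_add _ _ (Finset.mem_univ i), mul_add]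
    congr 1
    rw [reducedSum, ← mul_assoc, hs, one_mul, Finset.sum_erase_eq_sub (Finset.mem_univ i)]
  rw [Finset.sum_mul, Finset.sum_congr rfl fun i _ => h1 i, Finset.sum_add_distrib,
    Finset.sum_sub_distrib, Finset.sum_const, Finset.card_univ, Fintype.card_fin]
  congr 1
  rw [nsmul_eq_mul]
  push_cast
  noncomm_ring

theorem sum_mul_sum_eq {A : Type*} [Ring A] {s : Fin 3 → A} (hs : ∀ i, s i * s i = 1) :
    (∑ i, s i) * ∑ i, s i = (∑ i, reducedSum s 1 i) + 3 := by
  have h1 : ∀ i, s i * ∑ j, s j = reducedSum s 1 i + 1 := by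
    intro i
    rw [← Finset.sum_erase_add _ _ (Finset.mem_univ i), mul_add, hs]
    rfl
  rw [Finset.sum_mul, Finset.sum_congr rfl fun i _ => h1 i, Finset.sum_add_distrib]
  simp

/-! ### The entrywise `ℓ¹` norm -/

section EntrySum
variable {ι : Type*} [Fintype ι]

/-- The entrywise `ℓ¹` norm of a matrix. -/
def entrySum (M : Matrix ι ι ℝ) : ℝ := ∑ v, ∑ w, |M v w|

theorem entrySum_nonneg (M : Matrix ι ι ℝ) : 0 ≤ entrySum M :=
  Finset.sum_nonneg fun _ _ => Finset.sum_nonneg fun _ _ => abs_nonneg _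

theorem entrySum_add_le (M N : Matrix ι ι ℝ) : entrySum (M + N) ≤ entrySum M + entrySum N := by
  simp only [entrySum, ← Finset.sum_add_distrib]
  exact Finset.sum_le_sum fun v _ => Finset.sum_le_sum fun w _ => abs_add_le _ _

theorem entrySum_smul (c : ℝ) (M : Matrix ι ι ℝ) : entrySum (c • M) = |c| * entrySum M := by
  simp [entrySum, abs_mul, Finset.mul_sum]

theorem abs_trace_le_entrySum (M : Matrix ι ι ℝ) : |M.trace| ≤ entrySum M :=
  (Finset.abs_sum_le_sum_abs _ _).trans <| Finset.sum_le_sum fun v _ =>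
    Finset.single_le_sum (f := fun w => |M v w|) (fun _ _ => abs_nonneg _) (Finset.mem_univ v)

/-- Left multiplication by a matrix with column sums at most `c`. -/
theorem entrySum_mul_le {A : Matrix ι ι ℝ} {c : ℝ} (hA : ∀ u, ∑ v, |A v u| ≤ c)
    (M : Matrix ι ι ℝ) : entrySum (A * M) ≤ c * entrySum M := by
  calc entrySum (A * M) ≤ ∑ v, ∑ w, ∑ u, |A v u| * |M u w| :=
        Finset.sum_le_sum fun v _ => Finset.sum_le_sum fun w _ => by
          simp only [Matrix.mul_apply, ← abs_mul]
          exact Finset.abs_sum_le_sum_abs _ _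
    _ = ∑ u, ∑ w, (∑ v, |A v u|) * |M u w| := by
        simp only [Finset.sum_mul]
        rw [Finset.sum_comm' (t' := Finset.univ) (s' := fun _ => Finset.univ) (by simp)]
        conv_lhs => enter [2, w]; rw [Finset.sum_comm]
        rw [Finset.sum_comm]
    _ ≤ ∑ u, ∑ w, c * |M u w| :=
        Finset.sum_le_sum fun u _ => Finset.sum_le_sum fun w _ =>
          mul_le_mul_of_nonneg_right (hA u) (abs_nonneg _)
    _ = c * entrySum M := by simp only [entrySum, Finset.mul_sum]

theorem entrySum_sum_le {κ : Type*} (s : Finset κ) (M : κ → Matrix ι ι ℝ) :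
    entrySum (∑ i ∈ s, M i) ≤ ∑ i ∈ s, entrySum (M i) :=
  Finset.le_sum_of_subadditive _ (by simp [entrySum]) entrySum_add_le _ _

variable [DecidableEq ι]

theorem entrySum_mul_permMatrix (M : Matrix ι ι ℝ) (σ : Equiv.Perm ι) :
    entrySum (M * σ.permMatrix ℝ) = entrySum M := by
  refine Finset.sum_congr rfl fun v _ => ?_
  rw [PEquiv.mul_toMatrix_toPEquiv]
  exact Equiv.sum_comp σ.symm fun w => |M v w|

theorem entrySum_mul_reducedSum_le (σ : Fin 3 → Equiv.Perm ι) (n : ℕ) (i : Fin 3)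
    (M : Matrix ι ι ℝ) :
    entrySum (M * reducedSum (fun i => (σ i).permMatrix ℝ) n i) ≤ 2 ^ n * entrySum M := by
  induction n generalizing i M with
  | zero => simp [reducedSum, entrySum_mul_permMatrix]
  | succ n ih =>
    rw [reducedSum, ← mul_assoc, Finset.mul_sum]
    refine (entrySum_sum_le _ _).trans ((Finset.sum_le_sum fun j _ => ih j _).trans_eq ?_)
    rw [entrySum_mul_permMatrix, Finset.sum_const, Finset.card_erase_of_mem (Finset.mem_univ i),
      Finset.card_univ, Fintype.card_fin]
    simp
    ring

end EntrySum

/-! ### Traces of nonbacktracking polynomials -/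

/-- The permutation matrix of a Markoff move. -/
noncomputable def moveMatrix (p : ℕ) (i : Fin 3) : Matrix (Vertex p) (Vertex p) ℝ :=
  (movePerm p i).permMatrix ℝ

theorem moveMatrix_apply (p : ℕ) (i : Fin 3) (v w : Vertex p) :
    moveMatrix p i v w = if movePerm p i v = w then 1 else 0 := by
  simp [moveMatrix, PEquiv.toMatrix_apply, Equiv.toPEquiv_apply]

theorem moveMatrix_mul_self (p : ℕ) [NeZero p] (i : Fin 3) :
    moveMatrix p i * moveMatrix p i = 1 := by
  rw [moveMatrix, ← Matrix.permMatrix_mul, movePerm_mul_self, Matrix.permMatrix_one]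

/-- Here `u` is a prefix accumulated by the induction. It is stored in reverse, because
`Equiv.Perm.permMatrix` reverses products: the product of the matrices of `u` and of `i` is the
matrix of `i :: u`. -/
theorem isBigO_trace_mul_reducedSum (n : ℕ) {i : Fin 3} {u : List (Fin 3)}
    (hu : (i :: u).IsChain (· ≠ ·)) :
    (fun p : Nat.Primes =>
      ((wordPerm p u).permMatrix ℝ * reducedSum (moveMatrix p) n i).trace)
        =O[primesAtTop] fun p => ((p : ℕ) : ℝ) := by
  induction n generalizing i u with
  | zero =>
    refine (isBigO_ncard_fixedPoints hu (List.cons_ne_nil _ _)).congr_left fun p => ?_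
    rw [reducedSum, moveMatrix, ← Matrix.permMatrix_mul, ← wordPerm_cons, Matrix.trace_permutation]
  | succ n ih =>
    refine (IsBigO.fun_sum fun j (hj : j ∈ (Finset.univ : Finset (Fin 3)).erase i) =>
      ih (List.isChain_cons_cons.2 ⟨(Finset.mem_erase.1 hj).1, hu⟩)).congr_left fun p => ?_
    rw [reducedSum, ← mul_assoc, Finset.mul_sum, Matrix.trace_sum]
    refine Finset.sum_congr rfl fun j _ => ?_
    rw [wordPerm_cons, Matrix.permMatrix_mul, moveMatrix]

theorem isBigO_trace_reducedSum (n : ℕ) (i : Fin 3) :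
    (fun p : Nat.Primes => (reducedSum (moveMatrix p) n i).trace)
      =O[primesAtTop] fun p => ((p : ℕ) : ℝ) := by
  refine (isBigO_trace_mul_reducedSum n (List.isChain_singleton i)).congr_left fun p => ?_
  simp [wordPerm]

theorem adj_iff {p : ℕ} {v w : Vertex p} : Adj v w ↔ ∃ i, movePerm p i v = w := by
  simp only [Fin.exists_fin_succ, Adj, Subtype.ext_iff, movePerm_apply_val, move]
  simp [eq_comm]

theorem adjMatrix_apply (p : ℕ) (v w : Vertex p) :
    adjMatrix p v w = if ∃ i, movePerm p i v = w then 1 else 0 := by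
  classical
  simp only [adjMatrix, Matrix.of_apply, adj_iff]

theorem abs_adjMatrix_le (p : ℕ) (v w : Vertex p) :
    |adjMatrix p v w| ≤ ∑ i, moveMatrix p i v w := by
  have h0 : ∀ i, 0 ≤ moveMatrix p i v w := fun i => by
    rw [moveMatrix_apply]; split_ifs <;> norm_num
  rw [adjMatrix_apply]
  split_ifs with h
  · obtain ⟨i, hi⟩ := h
    refine le_trans ?_ (Finset.single_le_sum (fun i _ => h0 i) (Finset.mem_univ i))
    simp [moveMatrix_apply, hi]
  · simpa using Finset.sum_nonneg fun i _ => h0 i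

theorem sum_abs_adjMatrix_le (p : ℕ) [NeZero p] (u : Vertex p) :
    ∑ v, |adjMatrix p v u| ≤ 3 := by
  refine (Finset.sum_le_sum fun v _ => abs_adjMatrix_le p v u).trans_eq ?_
  rw [Finset.sum_comm]
  have : ∀ i, ∑ v, moveMatrix p i v u = 1 := fun i => by
    simp only [moveMatrix_apply]
    rw [Equiv.sum_comp (movePerm p i) fun v => if v = u then (1 : ℝ) else 0]
    simp
  simp [this]

/-- The adjacency matrix differs from the sum of the three permutation matrices only in the rows of
vertices at which two of the moves agree. -/
theorem abs_adjMatrix_sub_le (p : ℕ) (v w : Vertex p) :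
    |(adjMatrix p - ∑ i, moveMatrix p i) v w| ≤
      ∑ i, ∑ j ∈ Finset.univ.erase i,
        if movePerm p i v = w ∧ movePerm p j v = w then (1 : ℝ) else 0 := by
  have hE : ∀ i : Fin 3, Finset.univ.erase i = {i + 1, i + 2} := by decide
  simp only [Matrix.sub_apply, Matrix.sum_apply, adjMatrix_apply, moveMatrix_apply, hE]
  have hne : ∀ i : Fin 3, i + 1 ≠ i + 2 := by decide
  simp only [Finset.sum_pair (hne _), Fin.sum_univ_three, Fin.exists_fin_succ]
  by_cases h0 : movePerm p 0 v = w <;> by_cases h1 : movePerm p 1 v = w <;>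
    by_cases h2 : movePerm p 2 v = w <;> (simp [h0, h1, h2]; try norm_num)

/-- Two moves `i` and `j` agree at `v` exactly when the word `[j, i]` fixes `v`. -/
theorem entrySum_adjMatrix_sub_le (p : ℕ) [NeZero p] :
    entrySum (adjMatrix p - ∑ i, moveMatrix p i) ≤
      ∑ i : Fin 3, ∑ j ∈ Finset.univ.erase i,
        ((Function.fixedPoints (wordPerm p [j, i])).ncard : ℝ) := by
  classical
  refine (Finset.sum_le_sum fun v _ => Finset.sum_le_sum fun w _ =>
    abs_adjMatrix_sub_le p v w).trans_eq ?_
  have : ∀ i j : Fin 3, ((Function.fixedPoints (wordPerm p [j, i])).ncard : ℝ) =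
      ∑ v, ∑ w, if movePerm p i v = w ∧ movePerm p j v = w then (1 : ℝ) else 0 := by
    intro i j
    rw [← Matrix.trace_permutation, Matrix.trace]
    refine Finset.sum_congr rfl fun v _ => ?_
    have hij : wordPerm p [j, i] v = v ↔ movePerm p j v = movePerm p i v := by
      rw [← (movePerm p j).apply_eq_iff_eq (x := movePerm p j v), movePerm_movePerm, eq_comm]
      rfl
    simp [PEquiv.toMatrix_apply, Equiv.toPEquiv_apply, ite_and, hij]
  simp only [this]
  rw [Finset.sum_congr rfl fun v _ => Finset.sum_comm, Finset.sum_comm]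
  refine Finset.sum_congr rfl fun i _ => ?_
  rw [Finset.sum_congr rfl fun v _ => Finset.sum_comm, Finset.sum_comm]

theorem isBigO_entrySum_adjMatrix_sub :
    (fun p : Nat.Primes => entrySum (adjMatrix p - ∑ i, moveMatrix p i))
      =O[primesAtTop] fun p => ((p : ℕ) : ℝ) := by
  have h : ∀ i ∈ (Finset.univ : Finset (Fin 3)), ∀ j ∈ Finset.univ.erase i, _ := fun i _ j hj =>
    isBigO_ncard_fixedPoints (w := [j, i])
      (List.isChain_cons_cons.2 ⟨(Finset.mem_erase.1 hj).1, List.isChain_singleton i⟩)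
      (List.cons_ne_nil _ _)
  refine (IsBigO.of_norm_le fun p => ?_).trans (IsBigO.fun_sum fun i hi => IsBigO.fun_sum (h i hi))
  rw [Real.norm_of_nonneg (entrySum_nonneg _)]
  exact entrySum_adjMatrix_sub_le p

/-- In the entrywise `ℓ¹` norm, the nonbacktracking polynomials of the adjacency matrix are `O(p)`
close to sums over reduced words. -/
theorem isBigO_entrySum_aeval_sub (n : ℕ) :
    (fun p : Nat.Primes => entrySum (Polynomial.aeval (adjMatrix p) (nonbacktracking n) -
      ∑ i, reducedSum (moveMatrix p) n i)) =O[primesAtTop] fun p => ((p : ℕ) : ℝ) := by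
  -- With `B` the sum of the move matrices and `Tₙ` the sum over reduced words,
  -- `qₙ₊₂(A) - Tₙ₊₂ = A (qₙ₊₁(A) - Tₙ₊₁) + (A - B) Tₙ₊₁ - 2 (qₙ(A) - Tₙ)`.
  have step : ∀ n, (fun p : Nat.Primes => entrySum ((adjMatrix p - ∑ i, moveMatrix p i) *
      ∑ i, reducedSum (moveMatrix p) n i)) =O[primesAtTop] fun p => ((p : ℕ) : ℝ) := by
    intro n
    refine (IsBigO.of_norm_le fun p => ?_).trans
      (isBigO_entrySum_adjMatrix_sub.const_mul_left (3 * 2 ^ n))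
    rw [Real.norm_of_nonneg (entrySum_nonneg _), Finset.mul_sum]
    refine (entrySum_sum_le _ _).trans ((Finset.sum_le_sum fun i _ =>
      entrySum_mul_reducedSum_le (movePerm p) n i _).trans_eq ?_)
    simp
    ring
  have left : ∀ M : ∀ p : Nat.Primes, Matrix (Vertex p) (Vertex p) ℝ,
      ((fun p => entrySum (M p)) =O[primesAtTop] fun p => ((p : ℕ) : ℝ)) →
      (fun p => entrySum (adjMatrix p * M p)) =O[primesAtTop] fun p => ((p : ℕ) : ℝ) := by
    intro M hM
    refine (IsBigO.of_norm_le fun p => ?_).trans (hM.const_mul_left 3)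
    rw [Real.norm_of_nonneg (entrySum_nonneg _)]
    exact entrySum_mul_le (sum_abs_adjMatrix_le p) _
  have comb : ∀ (M N : ∀ p : Nat.Primes, Matrix (Vertex p) (Vertex p) ℝ),
      ((fun p => entrySum (M p)) =O[primesAtTop] fun p => ((p : ℕ) : ℝ)) →
      ((fun p => entrySum (N p)) =O[primesAtTop] fun p => ((p : ℕ) : ℝ)) →
      (fun p => entrySum (M p + N p)) =O[primesAtTop] fun p => ((p : ℕ) : ℝ) := by
    intro M N hM hN
    refine (IsBigO.of_norm_le fun p => ?_).trans (hM.add hN)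
    rw [Real.norm_of_nonneg (entrySum_nonneg _)]
    exact entrySum_add_le _ _
  induction n using Nat.twoStepInduction with
  | zero =>
    simpa [nonbacktracking, reducedSum] using isBigO_entrySum_adjMatrix_sub
  | one =>
    refine (comb _ _ (left _ isBigO_entrySum_adjMatrix_sub) (step 0)).congr_left fun p => ?_
    congr 1
    have h := sum_mul_sum_eq (moveMatrix_mul_self p)
    simp only [nonbacktracking, map_sub, map_pow, Polynomial.aeval_X, map_ofNat]
    rw [eq_sub_of_add_eq h.symm]
    simp only [reducedSum]
    noncomm_ring
  | more n h0 h1 =>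
    refine (comb _ _ (comb _ _ (left _ h1) (step (n + 1)))
      ((h0.const_mul_left |(-2 : ℝ)|).congr_left fun p => (entrySum_smul _ _).symm)).congr_left
        fun p => ?_
    congr 1
    have h := sum_mul_reducedSum (moveMatrix_mul_self p) n
    simp only [nonbacktracking, map_sub, map_mul, Polynomial.aeval_X, map_ofNat]
    rw [eq_sub_of_add_eq h.symm]
    rw [neg_smul, ofNat_smul_eq_nsmul]
    noncomm_ring

/-- Since nonempty reduced words have few fixed points, the nonbacktracking polynomials of `A` have
small trace. -/
theorem isBigO_trace_nonbacktracking (n : ℕ) :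
    (fun p : Nat.Primes => (Polynomial.aeval (adjMatrix p) (nonbacktracking n)).trace)
      =O[primesAtTop] fun p => ((p : ℕ) : ℝ) := by
  have h1 : (fun p : Nat.Primes => (Polynomial.aeval (adjMatrix p) (nonbacktracking n) -
      ∑ i, reducedSum (moveMatrix p) n i).trace) =O[primesAtTop] fun p => ((p : ℕ) : ℝ) :=
    (IsBigO.of_norm_le fun p => abs_trace_le_entrySum _).trans (isBigO_entrySum_aeval_sub n)
  refine (h1.add (IsBigO.fun_sum fun i (_ : i ∈ Finset.univ) =>
    isBigO_trace_reducedSum n i)).congr_left fun p => ?_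
  rw [Matrix.trace_sub, Matrix.trace_sum]
  ring

end Markoff

namespace Markoff
open Filter Asymptotics

/-! ### Integrals against the Kesten–McKay density -/

open Real intervalIntegral

theorem five_sub_four_cos_pos (θ : ℝ) : 0 < 5 - 4 * cos (2 * θ) := by
  linarith [cos_le_one (2 * θ)]

/-- The unnormalized cosine coefficients on `[0, π]` of the Poisson kernel `1 / (5 - 4 cos 2θ)`. -/
noncomputable def poissonCoeff (k : ℤ) : ℝ := ∫ θ in (0 : ℝ)..π, cos (k * θ) / (5 - 4 * cos (2 * θ))

theorem intervalIntegrable_div_five_sub {g : ℝ → ℝ} (hg : Continuous g) :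
    IntervalIntegrable (fun θ => g θ / (5 - 4 * cos (2 * θ))) MeasureTheory.volume 0 π :=
  (hg.div (by fun_prop) fun θ => (five_sub_four_cos_pos θ).ne').intervalIntegrable _ _

/-- Multiply `1 / (5 - 4 cos 2θ)` by
`2 cos 2θ cos kθ = (5/2) cos kθ - (1/2) (5 - 4 cos 2θ) cos kθ`. -/
theorem poissonCoeff_add_poissonCoeff (k : ℤ) :
    poissonCoeff (k + 2) + poissonCoeff (k - 2) =
      5 / 2 * poissonCoeff k - 1 / 2 * ∫ θ in (0 : ℝ)..π, cos (k * θ) := by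
  have hI : ∀ j : ℤ, IntervalIntegrable (fun θ : ℝ => cos (j * θ) / (5 - 4 * cos (2 * θ)))
      MeasureTheory.volume 0 π := fun j => intervalIntegrable_div_five_sub (by fun_prop)
  have hC : IntervalIntegrable (fun θ : ℝ => cos (k * θ)) MeasureTheory.volume 0 π :=
    Continuous.intervalIntegrable (by fun_prop) _ _
  rw [poissonCoeff, poissonCoeff, poissonCoeff, ← integral_add (hI _) (hI _),
    ← integral_const_mul, ← integral_const_mul,
    ← integral_sub ((hI k).const_mul _) (hC.const_mul _)]
  refine integral_congr fun θ _ => ?_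
  have h := (five_sub_four_cos_pos θ).ne'
  have h1 : cos (((k + 2 : ℤ) : ℝ) * θ) + cos (((k - 2 : ℤ) : ℝ) * θ) =
      2 * cos (2 * θ) * cos (k * θ) := by
    push_cast
    rw [add_mul, sub_mul, cos_add, cos_sub]
    ring
  have h2 : cos (k * θ) / (5 - 4 * cos (2 * θ)) * (5 - 4 * cos (2 * θ)) = cos (k * θ) :=
    div_mul_cancel₀ _ h
  rw [← add_div, h1, div_eq_iff h]
  linear_combination (-5 / 2) * h2

theorem integral_cos_int_mul {k : ℤ} (hk : k ≠ 0) : ∫ θ in (0 : ℝ)..π, cos (k * θ) = 0 := by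
  have hk' : (k : ℝ) ≠ 0 := Int.cast_ne_zero.2 hk
  rw [integral_comp_mul_left (fun θ => cos θ) hk', integral_cos]
  simp [sin_int_mul_pi]

theorem abs_poissonCoeff_le (k : ℤ) : |poissonCoeff k| ≤ π := by
  have h := norm_integral_le_of_norm_le_const (a := 0) (b := π) (C := 1)
    (f := fun θ => cos (k * θ) / (5 - 4 * cos (2 * θ))) fun θ _ => by
      rw [Real.norm_eq_abs, abs_div, abs_of_pos (five_sub_four_cos_pos θ),
        div_le_one (five_sub_four_cos_pos θ)]
      linarith [abs_cos_le_one (k * θ), cos_le_one (2 * θ)]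
  simpa [poissonCoeff, abs_of_pos pi_pos] using h

/-- The bound on `k` keeps the recurrence at `k + 2, k + 4, …` away from the index `0`, where it is
inhomogeneous. -/
theorem poissonCoeff_add_two {k : ℤ} (hk : -1 < k) :
    poissonCoeff (k + 2) = poissonCoeff k / 2 := by
  -- The defect `δ` doubles at each step of the recurrence, while the coefficients are bounded.
  set δ : ℝ := poissonCoeff (k + 2) - poissonCoeff k / 2 with hδ
  have hd : ∀ n : ℕ, poissonCoeff (k + 2 * n + 2) - poissonCoeff (k + 2 * n) / 2 = 2 ^ n * δ := by
    intro n
    induction n with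
    | zero => simp [hδ]
    | succ n ih =>
      have h := poissonCoeff_add_poissonCoeff (k + 2 * n + 2)
      rw [integral_cos_int_mul (by omega), add_sub_cancel_right] at h
      have e : k + 2 * ((n + 1 : ℕ) : ℤ) = k + 2 * n + 2 := by push_cast; ring
      rw [e, pow_succ]
      linarith
  have hb : ∀ n : ℕ, 2 ^ n * |δ| ≤ 2 * π := by
    intro n
    have h1 := abs_poissonCoeff_le (k + 2 * n + 2)
    have h2 := abs_poissonCoeff_le (k + 2 * n)
    calc 2 ^ n * |δ| = |2 ^ n * δ| := by
          rw [abs_mul, abs_of_pos (show (0 : ℝ) < 2 ^ n by positivity)]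
      _ ≤ 2 * π := by
        rw [← hd n]
        rw [abs_le] at *
        constructor <;> linarith
  have h0 : δ = 0 := by
    by_contra hne
    have hpos := abs_pos.2 hne
    obtain ⟨n, hn⟩ := pow_unbounded_of_one_lt (2 * π / |δ|) one_lt_two
    rw [div_lt_iff₀ hpos] at hn
    exact absurd (hb n) (not_le.2 hn)
  linarith

theorem poissonCoeff_zero : poissonCoeff 0 = π / 3 := by
  have h := poissonCoeff_add_poissonCoeff 0
  have h2 := poissonCoeff_add_two (k := 0) (by norm_num)
  have h3 : poissonCoeff (0 - 2) = poissonCoeff (0 + 2) := by simp [poissonCoeff]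
  rw [h3, h2] at h
  simp at h
  linarith

theorem poissonCoeff_one : poissonCoeff 1 = 0 := by
  have h := poissonCoeff_add_poissonCoeff 1
  rw [integral_cos_int_mul one_ne_zero, poissonCoeff_add_two (by norm_num)] at h
  have h3 : poissonCoeff (1 - 2) = poissonCoeff 1 := by simp [poissonCoeff]
  rw [h3] at h
  linarith

/-- In the variable `x = 2√2 cos θ`, the Kesten–McKay density becomes `(12/π) sin² θ` times the
Poisson kernel. -/
theorem integral_mul_kestenMcKay {φ : ℝ → ℝ} (hφ : Continuous φ) :
    ∫ x in (-(2 * √2))..(2 * √2), φ x * kestenMcKay 3 x =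
      12 / π * ∫ θ in (0 : ℝ)..π, φ (2 * √2 * cos θ) * sin θ ^ 2 / (5 - 4 * cos (2 * θ)) := by
  have hs : √2 ^ 2 = (2 : ℝ) := sq_sqrt (by norm_num)
  have h1 : ∫ x in (-(2 * √2))..(2 * √2), φ x * kestenMcKay 3 x =
      ∫ x in (-(2 * √2))..(2 * √2), φ x * (3 / (2 * π) * (√(8 - x ^ 2) / (9 - x ^ 2))) := by
    refine integral_congr fun x hx => ?_
    rw [Set.uIcc_of_le (by linarith [sqrt_nonneg 2])] at hx
    simp only [kestenMcKay]
    rw [Set.indicator_of_mem (by norm_num; exact hx)]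
    norm_num
  have h2 := integral_comp_mul_deriv'' (a := 0) (b := π) (f := fun θ => 2 * √2 * cos θ)
    (f' := fun θ => 2 * √2 * -sin θ)
    (g := fun x => φ x * (3 / (2 * π) * (√(8 - x ^ 2) / (9 - x ^ 2))))
    (by fun_prop) (fun θ _ => ((hasDerivAt_cos θ).const_mul _).hasDerivWithinAt)
    (by fun_prop) (by
      refine ContinuousOn.mul hφ.continuousOn (continuousOn_const.mul
        (ContinuousOn.div (by fun_prop) (by fun_prop) ?_))
      rintro _ ⟨θ, -, rfl⟩
      simp only
      rw [mul_pow, mul_pow, hs]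
      nlinarith [sin_sq_add_cos_sq θ, sq_nonneg (sin θ)])
  simp only [cos_zero, cos_pi, mul_one, mul_neg] at h2
  rw [h1, integral_symm, ← h2, ← integral_neg, ← integral_const_mul]
  refine integral_congr fun θ hθ => ?_
  rw [Set.uIcc_of_le pi_pos.le] at hθ
  have hsin := sin_nonneg_of_mem_Icc hθ
  have h3 : √(8 - (2 * √2 * cos θ) ^ 2) = 2 * √2 * sin θ := by
    rw [← sqrt_sq (show 0 ≤ 2 * √2 * sin θ by positivity)]
    congr 1
    linear_combination (4 * cos θ ^ 2 + 4 * sin θ ^ 2) * -hs - 8 * sin_sq_add_cos_sq θ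
  have h4 : 9 - (2 * √2 * cos θ) ^ 2 = 5 - 4 * cos (2 * θ) := by
    rw [cos_two_mul]
    linear_combination (-4 * cos θ ^ 2) * hs
  have h5 := (five_sub_four_cos_pos θ).ne'
  simp only [Function.comp]
  rw [h3, h4]
  field_simp
  linear_combination (6 * φ (2 * √2 * cos θ) * sin θ ^ 2) * hs

/-- The Kesten–McKay density has total mass `1`. -/
theorem integral_kestenMcKay : ∫ x in (-(2 * √2))..(2 * √2), kestenMcKay 3 x = 1 := by
  have h := integral_mul_kestenMcKay (φ := fun _ => 1) continuous_const
  have hI : ∀ j : ℤ, IntervalIntegrable (fun θ : ℝ => cos (j * θ) / (5 - 4 * cos (2 * θ)))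
      MeasureTheory.volume 0 π := fun j => intervalIntegrable_div_five_sub (by fun_prop)
  have h1 : ∫ θ in (0 : ℝ)..π, 1 * sin θ ^ 2 / (5 - 4 * cos (2 * θ)) =
      1 / 2 * (poissonCoeff 0 - poissonCoeff 2) := by
    rw [poissonCoeff, poissonCoeff, ← integral_sub (hI 0) (hI 2), ← integral_const_mul]
    refine integral_congr fun θ _ => ?_
    rw [← sub_div, sin_sq_eq_half_sub]
    push_cast
    rw [zero_mul, cos_zero]
    ring
  have h2 := poissonCoeff_add_two (k := 0) (by norm_num)
  rw [zero_add] at h2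
  rw [h1, h2, poissonCoeff_zero] at h
  simp only [one_mul] at h
  rw [h]
  field_simp
  norm_num

/-- Up to scaling, `q_n(2√2 cos θ)` is `U_{n+1}(cos θ) - U_{n-1}(cos θ) / 2`, where
`sin θ · U_k(cos θ) = sin ((k+1)θ)`. -/
theorem sin_mul_eval_nonbacktracking (n : ℕ) (θ : ℝ) :
    sin θ * (nonbacktracking n).eval (2 * √2 * cos θ) =
      √2 ^ (n + 1) * (sin ((n + 2) * θ) - 1 / 2 * sin (n * θ)) := by
  have hs : √2 ^ 2 = (2 : ℝ) := sq_sqrt (by norm_num)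
  induction n using Nat.twoStepInduction with
  | zero =>
    simp [nonbacktracking, sin_two_mul]
    ring
  | one =>
    have : sin ((2 + 1) * θ) = sin θ * (4 * cos θ ^ 2 - 1) := by
      rw [show (2 + 1) * θ = 3 * θ by ring, sin_three_mul]
      linear_combination (-4 * sin θ) * sin_sq_add_cos_sq θ
    simp [nonbacktracking]
    rw [show (1 + 2) * θ = (2 + 1) * θ by ring, this]
    linear_combination (4 * sin θ * cos θ ^ 2) * hs
  | more n h0 h1 =>
    simp only [nonbacktracking, Polynomial.eval_sub, Polynomial.eval_mul, Polynomial.eval_X,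
      Polynomial.eval_ofNat]
    push_cast at h1 ⊢
    have a1 : sin ((n + 2 + 2) * θ) = 2 * cos θ * sin ((n + 1 + 2) * θ) - sin ((n + 2) * θ) := by
      rw [show ((n : ℝ) + 2 + 2) * θ = (n + 1 + 2) * θ + θ by ring,
        show ((n : ℝ) + 2) * θ = (n + 1 + 2) * θ - θ by ring, sin_add, sin_sub]
      ring
    have a2 : sin ((n + 2) * θ) = 2 * cos θ * sin ((n + 1) * θ) - sin (n * θ) := by
      rw [show ((n : ℝ) + 2) * θ = (n + 1) * θ + θ by ring,
        show (n : ℝ) * θ = (n + 1) * θ - θ by ring, sin_add, sin_sub]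
      ring
    have e : sin θ * (2 * √2 * cos θ * (nonbacktracking (n + 1)).eval (2 * √2 * cos θ) -
        2 * (nonbacktracking n).eval (2 * √2 * cos θ)) =
        2 * √2 * cos θ * (√2 ^ (n + 1 + 1) * (sin ((n + 1 + 2) * θ) - 1 / 2 * sin ((n + 1) * θ)))
          - 2 * (√2 ^ (n + 1) * (sin ((n + 2) * θ) - 1 / 2 * sin (n * θ))) := by
      rw [← h0, ← h1]
      ring
    rw [e, a1, pow_succ (√2) (n + 2), pow_succ (√2) (n + 1)]
    have a3 : sin (n * θ) = 2 * cos θ * sin ((n + 1) * θ) - sin ((n + 2) * θ) := by linarith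
    rw [a3]
    linear_combination (√2 ^ (n + 1) * (3 / 2 * sin ((n + 2) * θ) - cos θ * sin ((n + 1) * θ))) * hs

/-- The nonbacktracking polynomials are orthogonal to `1` for the Kesten–McKay density. -/
theorem integral_nonbacktracking_mul_kestenMcKay (n : ℕ) :
    ∫ x in (-(2 * √2))..(2 * √2), (nonbacktracking n).eval x * kestenMcKay 3 x = 0 := by
  rw [integral_mul_kestenMcKay (nonbacktracking n).continuous]
  have hI : ∀ j : ℤ, IntervalIntegrable (fun θ : ℝ => cos (j * θ) / (5 - 4 * cos (2 * θ)))
      MeasureTheory.volume 0 π := fun j => intervalIntegrable_div_five_sub (by fun_prop)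
  have h1 : ∫ θ in (0 : ℝ)..π, (nonbacktracking n).eval (2 * √2 * cos θ) * sin θ ^ 2 /
      (5 - 4 * cos (2 * θ)) = √2 ^ (n + 1) / 2 * ((poissonCoeff (n + 1) - poissonCoeff (n + 3)) -
        1 / 2 * (poissonCoeff (n - 1) - poissonCoeff (n + 1))) := by
    rw [poissonCoeff, poissonCoeff, poissonCoeff, ← integral_sub (hI _) (hI _),
      ← integral_sub (hI _) (hI _), ← integral_const_mul,
      ← integral_sub ((hI _).sub (hI _)) (((hI _).sub (hI _)).const_mul _), ← integral_const_mul]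
    refine integral_congr fun θ _ => ?_
    have e := sin_mul_eval_nonbacktracking n θ
    push_cast
    have c1 : cos (((n : ℝ) + 1) * θ) - cos ((n + 3) * θ) = 2 * sin θ * sin ((n + 2) * θ) := by
      rw [show ((n : ℝ) + 1) * θ = (n + 2) * θ - θ by ring,
        show ((n : ℝ) + 3) * θ = (n + 2) * θ + θ by ring, cos_add, cos_sub]
      ring
    have c2 : cos (((n : ℝ) - 1) * θ) - cos ((n + 1) * θ) = 2 * sin θ * sin (n * θ) := by
      rw [show ((n : ℝ) - 1) * θ = n * θ - θ by ring,
        show ((n : ℝ) + 1) * θ = n * θ + θ by ring, cos_add, cos_sub]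
      ring
    rw [← sub_div, ← sub_div, c1, c2]
    linear_combination sin θ / (5 - 4 * cos (2 * θ)) * e
  rw [h1]
  rcases n with _ | n
  · have h3 := poissonCoeff_add_two (k := 1) (by norm_num)
    have hm : poissonCoeff (-1) = poissonCoeff 1 := by simp [poissonCoeff]
    norm_num at h3 ⊢
    rw [h3, hm, poissonCoeff_one]
    simp
  · have a1 := poissonCoeff_add_two (k := n) (by omega)
    have a2 := poissonCoeff_add_two (k := n + 2) (by omega)
    have e1 : ((n + 1 : ℕ) : ℤ) + 1 = n + 2 := by push_cast; ring
    have e2 : ((n + 1 : ℕ) : ℤ) + 3 = n + 2 + 2 := by push_cast; ring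
    have e3 : ((n + 1 : ℕ) : ℤ) - 1 = n := by push_cast; ring
    rw [e1, e2, e3, a2, a1]
    ring

end Markoff

namespace Markoff
open Filter Asymptotics

/-! ### From nonbacktracking polynomials to all polynomials -/

theorem trace_aeval_eq_sum_eigenvalues {ι : Type*} [Fintype ι] [DecidableEq ι]
    {A : Matrix ι ι ℝ} (hA : A.IsHermitian) (q : ℝ[X]) :
    (Polynomial.aeval A q).trace = ∑ i, q.eval (hA.eigenvalues i) := by
  have h : Polynomial.aeval A q = Unitary.conjStarAlgAut ℝ _ hA.eigenvectorUnitary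
      (Matrix.diagonal fun i => q.eval (hA.eigenvalues i)) := by
    conv_lhs => rw [hA.spectral_theorem]
    rw [Polynomial.aeval_algHom_apply]
    congr 1
    refine (Polynomial.aeval_algHom_apply (Matrix.diagonalAlgHom (n := ι) (α := ℝ) ℝ)
      hA.eigenvalues q).trans (congrArg Matrix.diagonal (funext fun i => ?_))
    exact (Polynomial.aeval_algHom_apply (Pi.evalAlgHom ℝ (fun _ : ι => ℝ) i)
      hA.eigenvalues q).symm
  rw [h, Unitary.conjStarAlgAut_apply, Matrix.trace_mul_cycle]
  simp [Matrix.trace_diagonal]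

/-- The average of a polynomial against the Kesten–McKay density of degree 3. -/
noncomputable def kestenMcKayMean (f : ℂ[X]) : ℂ :=
  ∫ x in (-(2 * √2))..(2 * √2), f.eval (x : ℂ) * (kestenMcKay 3 x : ℂ)

theorem continuousOn_kestenMcKay :
    ContinuousOn (kestenMcKay 3) (Set.uIcc (-(2 * √2)) (2 * √2)) := by
  have hs : √2 ^ 2 = (2 : ℝ) := Real.sq_sqrt (by norm_num)
  have h0 := Real.sqrt_nonneg 2
  rw [Set.uIcc_of_le (by linarith)]
  have h : ContinuousOn (fun x : ℝ => 3 / (2 * Real.pi) * (√(8 - x ^ 2) / (9 - x ^ 2)))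
      (Set.Icc (-(2 * √2)) (2 * √2)) := by
    refine continuousOn_const.mul (ContinuousOn.div (by fun_prop) (by fun_prop) fun x hx => ?_)
    have : x ^ 2 ≤ 8 := by nlinarith [hx.1, hx.2]
    linarith
  refine h.congr fun x hx => ?_
  simp only [kestenMcKay]
  rw [Set.indicator_of_mem (by norm_num; exact hx)]
  norm_num

theorem intervalIntegrable_eval_mul_kestenMcKay (f : ℂ[X]) :
    IntervalIntegrable (fun x : ℝ => f.eval (x : ℂ) * (kestenMcKay 3 x : ℂ))
      MeasureTheory.volume (-(2 * √2)) (2 * √2) :=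
  ContinuousOn.intervalIntegrable (ContinuousOn.mul (by fun_prop)
    (Complex.continuous_ofReal.comp_continuousOn continuousOn_kestenMcKay))

theorem kestenMcKayMean_add (f g : ℂ[X]) :
    kestenMcKayMean (f + g) = kestenMcKayMean f + kestenMcKayMean g := by
  simp only [kestenMcKayMean, Polynomial.eval_add, add_mul]
  exact intervalIntegral.integral_add (intervalIntegrable_eval_mul_kestenMcKay f)
    (intervalIntegrable_eval_mul_kestenMcKay g)

theorem kestenMcKayMean_smul (c : ℂ) (f : ℂ[X]) :
    kestenMcKayMean (c • f) = c * kestenMcKayMean f := by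
  simp only [kestenMcKayMean, Polynomial.eval_smul, smul_eq_mul, mul_assoc]
  exact intervalIntegral.integral_const_mul _ _

theorem kestenMcKayMean_map (q : ℝ[X]) :
    kestenMcKayMean (q.map Complex.ofRealHom) =
      ((∫ x in (-(2 * √2))..(2 * √2), q.eval x * kestenMcKay 3 x : ℝ) : ℂ) := by
  rw [kestenMcKayMean, ← intervalIntegral.integral_ofReal]
  refine intervalIntegral.integral_congr fun x _ => ?_
  have : (q.map Complex.ofRealHom).eval (x : ℂ) = ((q.eval x : ℝ) : ℂ) :=
    Polynomial.eval_map_apply (f := Complex.ofRealHom) x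
  simp [this]

/-- The polynomials whose sum over the eigenvalues agrees, up to `O(p)`, with `|M(𝔽_p)|` times their
Kesten–McKay mean. -/
noncomputable def equidistributed : Submodule ℂ ℂ[X] where
  carrier := {f | (fun p : Nat.Primes => ∑ j : Vertex p, f.eval (eigenvalue p j : ℂ) -
    (Nat.card (Vertex p) : ℂ) * kestenMcKayMean f) =O[primesAtTop] fun p => ((p : ℕ) : ℝ)}
  zero_mem' := by
    refine (isBigO_zero _ _).congr_left fun p => ?_
    simp [kestenMcKayMean]
  add_mem' {f g} hf hg := by
    refine (IsBigO.add hf hg).congr_left fun p => ?_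
    simp only [Polynomial.eval_add, Finset.sum_add_distrib, kestenMcKayMean_add]
    ring
  smul_mem' c f hf := by
    refine (IsBigO.const_mul_left hf c).congr_left fun p => ?_
    simp only [Polynomial.eval_smul, smul_eq_mul, ← Finset.mul_sum, kestenMcKayMean_smul]
    ring

theorem one_mem_equidistributed : 1 ∈ equidistributed := by
  change _ =O[primesAtTop] _
  refine (isBigO_zero _ _).congr_left fun p => ?_
  have h := kestenMcKayMean_map 1
  simp only [Polynomial.map_one, Polynomial.eval_one, one_mul, integral_kestenMcKay,
    Complex.ofReal_one] at h
  simp [h]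

theorem map_nonbacktracking_mem_equidistributed (n : ℕ) :
    (nonbacktracking n).map Complex.ofRealHom ∈ equidistributed := by
  change _ =O[primesAtTop] _
  refine (IsBigO.of_norm_le fun p => le_of_eq ?_).trans (isBigO_trace_nonbacktracking n).norm_left
  rw [kestenMcKayMean_map, integral_nonbacktracking_mul_kestenMcKay,
    trace_aeval_eq_sum_eigenvalues (isHermitian_adjMatrix p)]
  have : ∀ x : ℝ, ((nonbacktracking n).map Complex.ofRealHom).eval (x : ℂ) =
      (((nonbacktracking n).eval x : ℝ) : ℂ) :=
    fun x => Polynomial.eval_map_apply (f := Complex.ofRealHom) x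
  simp only [this]
  rw [← Complex.ofReal_sum, Complex.ofReal_zero, mul_zero, sub_zero, Complex.norm_real]
  rfl

theorem span_nonbacktracking_eq_top :
    Submodule.span ℂ (insert 1 (Set.range fun n => (nonbacktracking n).map Complex.ofRealHom)) =
      (⊤ : Submodule ℂ ℂ[X]) := by
  set V := Submodule.span ℂ
    (insert 1 (Set.range fun n => (nonbacktracking n).map Complex.ofRealHom))
  have h1 : (1 : ℂ[X]) ∈ V := Submodule.subset_span (Set.mem_insert _ _)
  have hn : ∀ n, (nonbacktracking n).map Complex.ofRealHom ∈ V := fun n =>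
    Submodule.subset_span (Set.mem_insert_of_mem _ ⟨n, rfl⟩)
  have h2 : Polynomial.C (2 : ℂ) = 2 := rfl
  have h3 : Polynomial.C (3 : ℂ) = 3 := rfl
  have hX : ∀ f ∈ V, Polynomial.X * f ∈ V := by
    intro f hf
    induction hf using Submodule.span_induction with
    | zero => simp
    | add f g _ _ hf hg => rw [mul_add]; exact V.add_mem hf hg
    | smul c f _ hf => rw [mul_smul_comm]; exact V.smul_mem c hf
    | mem f hf =>
      rcases hf with rfl | ⟨n, rfl⟩
      · simpa [nonbacktracking] using hn 0
      · rcases n with _ | n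
        · have h := V.add_mem (hn 1) (V.smul_mem 3 h1)
          convert h using 1
          simp [nonbacktracking, Polynomial.smul_eq_C_mul, h3, sq]
        · have h := V.add_mem (hn (n + 2)) (V.smul_mem 2 (hn n))
          convert h using 1
          simp [nonbacktracking, Polynomial.smul_eq_C_mul, h2]
  rw [eq_top_iff]
  rintro f -
  induction f using Polynomial.induction_on' with
  | add f g hf hg => exact V.add_mem hf hg
  | monomial n c =>
    rw [← Polynomial.C_mul_X_pow_eq_monomial, ← Polynomial.smul_eq_C_mul]
    refine V.smul_mem c ?_
    induction n with
    | zero => simpa using h1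
    | succ n ih => rw [pow_succ']; exact hX _ ih

theorem mem_equidistributed (f : ℂ[X]) : f ∈ equidistributed := by
  have h : (⊤ : Submodule ℂ ℂ[X]) ≤ equidistributed := by
    rw [← span_nonbacktracking_eq_top, Submodule.span_le, Set.insert_subset_iff]
    exact ⟨one_mem_equidistributed, by
      rintro _ ⟨n, rfl⟩
      exact map_nonbacktracking_mem_equidistributed n⟩
  exact h Submodule.mem_top

theorem isBigO_card_vertex_sub_normalization :
    (fun p : Nat.Primes => (Nat.card (Vertex p) : ℝ) - normalization p)
      =O[primesAtTop] fun p => ((p : ℕ) : ℝ) := by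
  have h : (fun p : Nat.Primes => ((p : ℕ) : ℝ) ^ 2 - normalization p)
      =O[primesAtTop] fun p => ((p : ℕ) : ℝ) := by
    refine IsBigO.of_bound 3 (Eventually.of_forall fun p => ?_)
    have h0 : (0 : ℝ) ≤ 3 * ((p : ℕ) : ℝ) := by positivity
    rw [Real.norm_natCast, normalization]
    split_ifs
    · rw [sub_add_cancel_left, norm_neg, Real.norm_of_nonneg h0]
    · rw [sub_sub_cancel, Real.norm_of_nonneg h0]
  exact (isBigO_card_vertex_sub_sq.add h).congr_left fun p => by ring

theorem sq_div_two_le_normalization {p : ℕ} (hp : 6 ≤ p) : (p : ℝ) ^ 2 / 2 ≤ normalization p := by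
  have h : (6 : ℝ) ≤ p := by exact_mod_cast hp
  rw [normalization]
  split_ifs <;> nlinarith

end Markoff

theorem theorem2 (f : ℂ[X]) :
    ∃ C : ℝ, ∃ p₀ : ℕ, ∀ (p : ℕ) [Fact p.Prime], p₀ ≤ p →
      ‖1 / (Markoff.normalization p : ℂ) *
            ∑ j : Markoff.Vertex p, f.eval (Markoff.eigenvalue p j : ℂ) -
          ∫ x in (-(2 * √2))..(2 * √2), f.eval (x : ℂ) * (Markoff.kestenMcKay 3 x : ℂ)‖
        ≤ C / p := by
  open Markoff Asymptotics Filter in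
  have h1 : (fun p : Nat.Primes => ∑ j : Vertex p, f.eval (eigenvalue p j : ℂ) -
      (Nat.card (Vertex p) : ℂ) * kestenMcKayMean f) =O[primesAtTop] fun p => ((p : ℕ) : ℝ) :=
    mem_equidistributed f
  have h2 : (fun p : Nat.Primes => (((Nat.card (Vertex p) : ℝ) - normalization p : ℝ) : ℂ) *
      kestenMcKayMean f) =O[primesAtTop] fun p => ((p : ℕ) : ℝ) := by
    simp only [mul_comm _ (kestenMcKayMean f)]
    exact ((IsBigO.of_norm_le fun p => (Complex.norm_real _).le).trans
      isBigO_card_vertex_sub_normalization.norm_left).const_mul_left _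
  obtain ⟨C, hC⟩ := (h1.add h2).bound
  obtain ⟨s, hs, hsub⟩ := Filter.mem_comap.1 hC
  obtain ⟨N, hN⟩ := Filter.mem_atTop_sets.1 hs
  refine ⟨2 * C, max N 6, fun p _ hp => ?_⟩
  have hb := hsub (show (⟨p, Fact.out⟩ : Nat.Primes) ∈ _ from hN p (le_of_max_le_left hp))
  simp only [Real.norm_natCast] at hb
  have hp6 := le_of_max_le_right hp
  have hn := sq_div_two_le_normalization hp6
  have hp0 : (0 : ℝ) < p := by exact_mod_cast (show 0 < p by omega)
  have hn0 : 0 < normalization p := lt_of_lt_of_le (by positivity) hn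
  have hne : (normalization p : ℂ) ≠ 0 := Complex.ofReal_ne_zero.2 hn0.ne'
  have key : 1 / (normalization p : ℂ) * ∑ j : Vertex p, f.eval (eigenvalue p j : ℂ) -
      kestenMcKayMean f = (∑ j : Vertex p, f.eval (eigenvalue p j : ℂ) -
        (Nat.card (Vertex p) : ℂ) * kestenMcKayMean f +
        (((Nat.card (Vertex p) : ℝ) - normalization p : ℝ) : ℂ) * kestenMcKayMean f) /
          normalization p := by
    push_cast
    field_simp
    ring
  change ‖1 / (normalization p : ℂ) * ∑ j : Vertex p, f.eval (eigenvalue p j : ℂ) -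
      kestenMcKayMean f‖ ≤ _
  rw [key, norm_div, Complex.norm_real, Real.norm_of_nonneg hn0.le]
  calc _ ≤ C * p / normalization p := by gcongr; exact hb
    _ ≤ 2 * C / p := by
      have hC0 : 0 ≤ C * p := (norm_nonneg _).trans hb
      have : 0 ≤ C := nonneg_of_mul_nonneg_left hC0 hp0
      rw [div_le_div_iff₀ hn0 hp0]
      nlinarith
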